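/- Let $\lambda<0$ be real, and let $\mathscr F$ be the singular holomorphic foliation of the unit bidisc $\mathbb D^2\subset\mathbb C^2$ defined by the linear vector field $Z=z\,\frac{\partial}{\partial z}+\lambda\,w\,\frac{\partial}{\partial w}$, with singular set $\{0\}$. Let $\mathscr C_{\mathscr F}$ (resp. $\mathscr C^{1,1}_{\mathscr F}$) be the space of functions (resp. leafwise $(1,1)$-forms) with compact support in $\mathbb D^2\setminus\{0\}$ that are smooth along the leaves and, with all their leafwise derivatives, transversally continuous. A directed harmonic current $T$ is a continuous linear form on $\mathscr C^{1,1}_{\mathscr F}$ which is positive ($T(\iota)\ge 0$ for all $\iota\ge 0$) and satisfies $T(i\partial\bar\partial f)=0$ for all $f\in\mathscr C_{\mathscr F}$, with $\partial\bar\partial$ taken along the leaves. Its mass on an open set $U\subset\mathbb D^2$ is $\|T\|_U=\int_U T\wedge\beta$, where $\beta=i\,dz\wedge d\bar z+i\,dw\wedge d\bar w$, and its Lelong number at the singularity is $$\mathscr L(T,0)=\limsup_{r\to0+}\frac1{\pi r^2}\,\|T\|_{r\mathbb D^2}\in[0,+\infty].$$ Let $T$ be a directed harmonic current with $\|T\|_{\mathbb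 D^2}<\infty$ which gives no mass to either of the two separatrices $\{z=0\}$ and $\{w=0\}$. 1. If $T$ is periodic, i.e. invariant under $(z,w)\mapsto(z,e^{2k\pi i\lambda}w)$ for some integer $k\ge1$, then $\mathscr L(T,0)=0$. 2. In particular, if $\lambda\in\mathbb Q_{<0}$, then $\mathscr L(T,0)=0$ (without assuming periodicity). -/

import Mathlib

open scoped ContDiff Topology ENNReal

noncomputable section

namespace LinFoliation

/-- The linear vector field `Z = z ∂/∂z + lam w ∂/∂w` on `ℂ²`, as a map `ℂ² → ℂ²`. -/
def vectorField (lam : ℝ) (p : ℂ × ℂ) : ℂ × ℂ := (p.1, (lam : ℂ) * p.2)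

/-- The holomorphic flow of `Z`. Away from the origin, `ζ ↦ flow lam ζ p` parametrizes the leaf
through `p`. -/
def flow (lam : ℝ) (ζ : ℂ) (p : ℂ × ℂ) : ℂ × ℂ :=
  (Complex.exp ζ * p.1, Complex.exp ((lam : ℂ) * ζ) * p.2)

theorem flow_zero (lam : ℝ) (p : ℂ × ℂ) : flow lam 0 p = p := by
  simp [flow]

theorem flow_flow (lam : ℝ) (ζ ξ : ℂ) (p : ℂ × ℂ) :
    flow lam ξ (flow lam ζ p) = flow lam (ζ + ξ) p := by
  ext
  · simp only [flow, Complex.exp_add]; ring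
  · simp only [flow, mul_add, Complex.exp_add]; ring

/-- The flow lines are the integral curves of `Z`. -/
theorem hasDerivAt_flow (lam : ℝ) (p : ℂ × ℂ) (ζ : ℂ) :
    HasDerivAt (fun ξ => flow lam ξ p) (vectorField lam (flow lam ζ p)) ζ := by
  have h1 : HasDerivAt (fun ξ : ℂ => Complex.exp ξ * p.1) (Complex.exp ζ * p.1) ζ :=
    (Complex.hasDerivAt_exp ζ).mul_const p.1
  have h2 : HasDerivAt (fun ξ : ℂ => Complex.exp ((lam : ℂ) * ξ) * p.2)
      ((lam : ℂ) * (Complex.exp ((lam : ℂ) * ζ) * p.2)) ζ := by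
    have h := (((hasDerivAt_id ζ).const_mul (lam : ℂ)).cexp).mul_const p.2
    simp only [id, mul_one] at h
    exact h.congr_deriv (by ring)
  exact h1.prodMk h2

theorem continuous_flow_left (lam : ℝ) (p : ℂ × ℂ) : Continuous fun ζ => flow lam ζ p := by
  unfold flow; fun_prop

/-- The bidisc `r 𝔻²`. -/
def bidisc (r : ℝ) : Set (ℂ × ℂ) := {p | ‖p.1‖ < r ∧ ‖p.2‖ < r}

/-- The regular part `𝔻² \ {0}` of the foliated bidisc. -/
def regularPart : Set (ℂ × ℂ) := bidisc 1 \ {0}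

/-- The restriction of `f` to the leaf through `p`, in the coordinate `ζ` of the flow. -/
def alongLeaf (lam : ℝ) (f : ℂ × ℂ → ℝ) (p : ℂ × ℂ) : ℂ → ℝ := fun ζ => f (flow lam ζ p)

/-- `f` has compact support in `𝔻² \ {0}`, is smooth along the leaves, and all its leafwise
derivatives are continuous (also transversally). -/
structure IsTest (lam : ℝ) (f : ℂ × ℂ → ℝ) : Prop where
  compact : HasCompactSupport f
  support : tsupport f ⊆ regularPart
  smooth : ∀ p, ContDiff ℝ ∞ (alongLeaf lam f p)
  cont : ∀ n : ℕ, Continuous fun p => iteratedFDeriv ℝ n (alongLeaf lam f p) 0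

/-- The space of compactly supported, leafwise smooth, transversally continuous real functions on
the foliated manifold `𝔻² \ {0}` (extended by zero to `ℂ²`). -/
def TestFunction (lam : ℝ) : Submodule ℝ (ℂ × ℂ → ℝ) where
  carrier := {f | IsTest lam f}
  add_mem' := by
    intro f g hf hg
    refine ⟨hf.compact.add hg.compact, ?_, fun p => (hf.smooth p).add (hg.smooth p), fun n => ?_⟩
    · exact (tsupport_add f g).trans (Set.union_subset hf.support hg.support)
    · have h : (fun p => iteratedFDeriv ℝ n (alongLeaf lam (f + g) p) 0) = fun p =>
          iteratedFDeriv ℝ n (alongLeaf lam f p) 0 + iteratedFDeriv ℝ n (alongLeaf lam g p) 0 := by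
        funext p
        exact iteratedFDeriv_add_apply
          (((hf.smooth p).of_le (by exact_mod_cast le_top)).contDiffAt)
          (((hg.smooth p).of_le (by exact_mod_cast le_top)).contDiffAt)
      rw [h]
      exact (hf.cont n).add (hg.cont n)
  zero_mem' := by
    have h0 : ∀ p, alongLeaf lam (0 : ℂ × ℂ → ℝ) p = fun _ => 0 := fun p => rfl
    refine ⟨HasCompactSupport.zero, by simp [tsupport], fun p => ?_, fun n => ?_⟩
    · rw [h0]; exact contDiff_const
    · simp only [h0]; exact continuous_const
  smul_mem' := by
    intro c f hf
    refine ⟨?_, ?_, fun p => (hf.smooth p).const_smul c, fun n => ?_⟩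
    · exact hf.compact.mono' ((Function.support_const_smul_subset c f).trans subset_closure)
    · exact (closure_mono (Function.support_const_smul_subset c f)).trans hf.support
    · have h : (fun p => iteratedFDeriv ℝ n (alongLeaf lam (c • f) p) 0) = fun p =>
          c • iteratedFDeriv ℝ n (alongLeaf lam f p) 0 := by
        funext p
        exact iteratedFDeriv_const_smul_apply
          (((hf.smooth p).of_le (by exact_mod_cast le_top)).contDiffAt)
      rw [h]
      exact (hf.cont n).const_smul c

/-- The space of compactly supported, leafwise smooth, transversally continuous real leafwise
`(1,1)`-forms on `𝔻² \ {0}`. Since `Z` has no zero there, each such form is `φ · i η ∧ η̄` for a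
unique test function `φ`, where `η` is the leafwise `(1,0)`-form with `η(Z) = 1` (so `η = dζ` in
the coordinate of the flow); the form is represented by `φ`. It is positive iff `φ ≥ 0`. -/
abbrev TestForm (lam : ℝ) : Type := TestFunction lam

/-- Derivative along the leaves: derivative of `ζ ↦ f (flow lam ζ p)` at `0` in the real
direction `v ∈ ℂ`. -/
def leafDeriv (lam : ℝ) (v : ℂ) (f : ℂ × ℂ → ℝ) (p : ℂ × ℂ) : ℝ :=
  fderiv ℝ (alongLeaf lam f p) 0 v

theorem alongLeaf_leafDeriv (lam : ℝ) (v : ℂ) (f : ℂ × ℂ → ℝ) (p : ℂ × ℂ) :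
    alongLeaf lam (leafDeriv lam v f) p = fun ζ => fderiv ℝ (alongLeaf lam f p) ζ v := by
  funext ζ
  have h : alongLeaf lam f (flow lam ζ p) = fun ξ => alongLeaf lam f p (ζ + ξ) := by
    funext ξ
    simp only [alongLeaf, flow_flow]
  change fderiv ℝ (alongLeaf lam f (flow lam ζ p)) 0 v = _
  rw [h, fderiv_comp_add_left, add_zero]

theorem IsTest.leafDeriv {lam : ℝ} {f : ℂ × ℂ → ℝ} (hf : IsTest lam f) (v : ℂ) :
    IsTest lam (leafDeriv lam v f) := by
  have hs : Function.support (LinFoliation.leafDeriv lam v f) ⊆ tsupport f := by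
    intro p hp
    by_contra hpf
    apply hp
    have h0 : alongLeaf lam f p =ᶠ[𝓝 0] fun _ => (0 : ℝ) := by
      have h1 : ∀ᶠ q in 𝓝 p, f q = 0 := notMem_tsupport_iff_eventuallyEq.mp hpf
      have h2 : Filter.Tendsto (fun ζ => flow lam ζ p) (𝓝 0) (𝓝 p) := by
        have := (continuous_flow_left lam p).tendsto 0
        rwa [flow_zero] at this
      exact h2.eventually h1
    simp [LinFoliation.leafDeriv, h0.fderiv_eq]
  have hd : ∀ p, ContDiff ℝ ∞ (fderiv ℝ (alongLeaf lam f p)) := fun p =>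
    (hf.smooth p).fderiv_right (by simp)
  refine ⟨hf.compact.mono' hs, (closure_minimal hs (isClosed_tsupport f)).trans hf.support,
    fun p => ?_, fun n => ?_⟩
  · rw [alongLeaf_leafDeriv]
    exact (hd p).clm_apply contDiff_const
  · let L : (ℂ →L[ℝ] ℝ) →L[ℝ] ℝ := ContinuousLinearMap.apply ℝ ℝ v
    let E := (continuousMultilinearCurryRightEquiv' ℝ n ℂ ℝ).symm
    have h : (fun p => iteratedFDeriv ℝ n (alongLeaf lam (LinFoliation.leafDeriv lam v f) p) 0) =
        fun p => L.compContinuousMultilinearMap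
          (E.symm (iteratedFDeriv ℝ (n + 1) (alongLeaf lam f p) 0)) := by
      funext p
      rw [alongLeaf_leafDeriv]
      have h1 : (fun ζ => fderiv ℝ (alongLeaf lam f p) ζ v) =
          L ∘ fderiv ℝ (alongLeaf lam f p) := rfl
      rw [h1, L.iteratedFDeriv_comp_left (hd p).contDiffAt (by exact_mod_cast le_top)]
      congr 1
      rw [iteratedFDeriv_succ_eq_comp_right]
      exact (E.symm_apply_apply _).symm
    rw [h]
    exact (ContinuousLinearMap.compContinuousMultilinearMapL ℝ (fun _ : Fin n => ℂ)
      (ℂ →L[ℝ] ℝ) ℝ L).continuous.comp (E.symm.continuous.comp (hf.cont (n + 1)))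

/-- `i ∂ ∂̄ f` along the leaves: in the coordinate `ζ` of the flow its coefficient with respect to
`i dζ ∧ dζ̄` is `∂²f/∂ζ∂ζ̄ = (1/4) Δ f`. -/
def ddbar {lam : ℝ} (f : TestFunction lam) : TestForm lam :=
  ⟨(1 / 4 : ℝ) • (leafDeriv lam 1 (leafDeriv lam 1 f.1) +
      leafDeriv lam Complex.I (leafDeriv lam Complex.I f.1)),
    (TestFunction lam).smul_mem _ ((TestFunction lam).add_mem
      ((IsTest.leafDeriv f.2 1).leafDeriv 1)
      ((IsTest.leafDeriv f.2 Complex.I).leafDeriv Complex.I))⟩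

/-- The homeomorphism `(z, w) ↦ (z, e^{2 k π i lam} w)`, the `k`-th power of the generator of the
monodromy group. -/
def monodromy (lam : ℝ) (k : ℕ) : ℂ × ℂ ≃ₜ ℂ × ℂ :=
  (Homeomorph.refl ℂ).prodCongr
    (Homeomorph.mulLeft₀ (Complex.exp (2 * k * Real.pi * Complex.I * lam)) (Complex.exp_ne_zero _))

theorem monodromy_apply (lam : ℝ) (k : ℕ) (p : ℂ × ℂ) :
    monodromy lam k p = (p.1, Complex.exp (2 * k * Real.pi * Complex.I * lam) * p.2) := rfl

theorem monodromy_flow (lam : ℝ) (k : ℕ) (ζ : ℂ) (p : ℂ × ℂ) :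
    monodromy lam k (flow lam ζ p) = flow lam ζ (monodromy lam k p) := by
  simp only [monodromy_apply, flow]
  ext
  · rfl
  · simp only; ring

theorem monodromy_mem (lam : ℝ) (k : ℕ) (p : ℂ × ℂ) :
    monodromy lam k p ∈ regularPart ↔ p ∈ regularPart := by
  have h : ‖Complex.exp (2 * k * Real.pi * Complex.I * lam)‖ = 1 := by
    have : (2 * k * Real.pi * Complex.I * lam : ℂ) = ((2 * k * Real.pi * lam : ℝ) : ℂ) *
        Complex.I := by push_cast; ring
    rw [this, Complex.norm_exp_ofReal_mul_I]
  simp [regularPart, bidisc, monodromy_apply, h, Prod.ext_iff]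

/-- The pull-back of a leafwise form by `(z, w) ↦ (z, e^{2 k π i lam} w)`. This map preserves `Z`,
hence `i η ∧ η̄`, so only the coefficient is composed. -/
def pullback {lam : ℝ} (k : ℕ) (φ : TestForm lam) : TestForm lam :=
  ⟨φ.1 ∘ monodromy lam k, by
    have hφ : IsTest lam φ.1 := φ.2
    have h : ∀ p, alongLeaf lam (φ.1 ∘ monodromy lam k) p =
        alongLeaf lam φ.1 (monodromy lam k p) := by
      intro p
      funext ζ
      simp only [alongLeaf, Function.comp, monodromy_flow]
    refine ⟨hφ.compact.comp_homeomorph _, ?_, fun p => ?_, fun n => ?_⟩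
    · rw [tsupport_comp_eq_preimage]
      intro p hp
      exact (monodromy_mem lam k p).mp (hφ.support hp)
    · rw [h]; exact hφ.smooth _
    · simp only [h]
      exact (hφ.cont n).comp (monodromy lam k).continuous⟩

/-- A harmonic current on `𝔻² \ {0}` directed by the foliation of `Z`: a continuous linear form on
the test forms which is positive and satisfies `i ∂ ∂̄ T = 0` in the weak sense. Continuity refers
to uniform convergence of all leafwise derivatives, with supports in a fixed compact set. -/
structure DirectedHarmonicCurrent (lam : ℝ) where
  toLinearMap : TestForm lam →ₗ[ℝ] ℝ
  continuity : ∀ K : Set (ℂ × ℂ), IsCompact K → K ⊆ regularPart →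
    ∃ (C : ℝ) (N : ℕ), ∀ (φ : TestForm lam) (B : ℝ), tsupport φ.1 ⊆ K →
      (∀ n ≤ N, ∀ p, ‖iteratedFDeriv ℝ n (alongLeaf lam φ.1 p) 0‖ ≤ B) →
      |toLinearMap φ| ≤ C * B
  positive : ∀ φ : TestForm lam, (∀ p, 0 ≤ φ.1 p) → 0 ≤ toLinearMap φ
  harmonic : ∀ f : TestFunction lam, toLinearMap (ddbar f) = 0

/-- The coefficient, with respect to `i η ∧ η̄`, of the restriction to the leaves of the Kähler form
`β = i dz ∧ dz̄ + i dw ∧ dw̄`. On the leaves, `dz = z η` and `dw = lam w η`. -/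
def kahlerCoeff (lam : ℝ) (p : ℂ × ℂ) : ℝ :=
  ‖(vectorField lam p).1‖ ^ 2 + ‖(vectorField lam p).2‖ ^ 2

namespace DirectedHarmonicCurrent

variable {lam : ℝ}

/-- The mass `‖T‖_U = ∫_U T ∧ β` of `T` on an open set `U`: the supremum of `T(φ)` over the test
forms `0 ≤ φ ≤ β` supported in `U`. -/
def mass (T : DirectedHarmonicCurrent lam) (U : Set (ℂ × ℂ)) : ℝ≥0∞ :=
  ⨆ (φ : TestForm lam) (_ : ∀ p, 0 ≤ φ.1 p ∧ φ.1 p ≤ kahlerCoeff lam p) (_ : tsupport φ.1 ⊆ U),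
    ENNReal.ofReal (T.toLinearMap φ)

/-- `T` gives no mass to the set `S`: the infimum of the masses of its open neighbourhoods
is `0`. -/
def NoMassOn (T : DirectedHarmonicCurrent lam) (S : Set (ℂ × ℂ)) : Prop :=
  ⨅ (U : Set (ℂ × ℂ)) (_ : IsOpen U) (_ : S ⊆ U), T.mass U = 0

/-- `T` is periodic: it is invariant under `(z, w) ↦ (z, e^{2 k π i lam} w)` for some `k ≥ 1`. -/
def IsPeriodic (T : DirectedHarmonicCurrent lam) : Prop :=
  ∃ k : ℕ, 1 ≤ k ∧ ∀ φ : TestForm lam, T.toLinearMap (pullback k φ) = T.toLinearMap φ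

/-- The Lelong number of `T` at the origin. -/
def lelongNumber (T : DirectedHarmonicCurrent lam) : ℝ≥0∞ :=
  Filter.limsup (fun r : ℝ => T.mass (bidisc r) / ENNReal.ofReal (Real.pi * r ^ 2)) (𝓝[>] 0)

end DirectedHarmonicCurrent

end LinFoliation

end

/-!
The Kähler form and the bidiscs are invariant under the rotations `(z, w) ↦ (e^{ia} z, e^{ib} w)`,
so the mass of `T` on `r 𝔻²` can be computed with test functions of `|z|` and `|w|` alone. In the
flow coordinate `ζ`, such a function depends only on `u = Re ζ` along each leaf, and `i ∂∂̄` becomes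
a quarter of the second derivative in `u`. As `lam < 0`, the leaves in `𝔻²` off the separatrices are
strips in `ζ` of bounded width in `u`, and they are distinguished, up to rotation, by the level
`s = |z|^{-lam} |w|`. Testing `T` against functions of `u` says that its rotation average has an
affine, nonnegative density in `u` on each strip. Such a density is controlled by its values at the
two ends of the strip, that is, by the mass of `T` at a definite distance from the origin; and only
strips with `s < r^{1 - lam}` meet `r 𝔻²`. Since `T` has no mass on `{s = 0}`, this mass tends to
`0` with `r`. In particular the averaging makes the argument independent of the monodromy.

The maximum principle for affine densities is made effective by one test function, `comparison`.
With `V = log ((r² + |z|²)(r² + |w|²) / r²)` (`logPotential`), a smooth cutoff `χ(s)`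
(`levelCutoff`), and a truncation `q` with `q(t) = t` for `t < -2` and `q(t) = 0` for `t ≥ -1`, it
is `r² χ q(V)`. On `r 𝔻²` the second derivative of `r² V` in `u` dominates the Kähler form, and it
is nonnegative wherever `q(V) = V`. In the transition region `-2 ≤ V ≤ -1` it is at least `-C r²`, with
`C` independent of `r`, and there `|z|` or `|w|` is bounded below by a constant
(`le_sq_norm_or_le_sq_norm`). This is `kahlerCoeff_le_ddbar_comparison`. Since `T` vanishes on the
`i ∂∂̄` of test functions, the mass on `r 𝔻²` is at most `C r²` times the mass of the level cutoff
on two annuli around the separatrices, which is small by `eventually_apply_fst_le` and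
`eventually_apply_snd_le`. The cutoff `χ` also has to vanish near `s = 0`; the part of a test form
lost in this way is negligible by `exists_bump_of_noMassOn`.
-/

namespace LinFoliation

/-! ### Smooth functions as test functions -/

theorem continuous_iteratedFDeriv_partial {P : Type} [NormedAddCommGroup P] [NormedSpace ℝ P]
    {g : P × ℂ → ℝ} (hg : ContDiff ℝ ∞ g) (n : ℕ) :
    Continuous fun p => iteratedFDeriv ℝ n (fun ζ => g (p, ζ)) 0 := by
  have h : (fun p => iteratedFDeriv ℝ n (fun ζ => g (p, ζ)) 0) = fun p =>
      (iteratedFDeriv ℝ n g (p, 0)).compContinuousLinearMap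
        fun _ => ContinuousLinearMap.inr ℝ P ℂ := by
    funext p
    have hs : ContDiff ℝ ∞ fun x => g ((p, 0) + x) := hg.comp (contDiff_const.add contDiff_id)
    have h1 : (fun ζ => g (p, ζ)) =
        (fun x => g ((p, 0) + x)) ∘ ContinuousLinearMap.inr ℝ P ℂ := by
      funext ζ; simp
    rw [h1, ContinuousLinearMap.iteratedFDeriv_comp_right _ hs _ (by exact_mod_cast le_top),
      iteratedFDeriv_comp_add_left]
    simp
  rw [h]
  exact (ContinuousMultilinearMap.compContinuousLinearMapL
    (fun _ : Fin n => ContinuousLinearMap.inr ℝ P ℂ)).continuous.comp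
    ((hg.continuous_iteratedFDeriv (by exact_mod_cast le_top)).comp (by fun_prop))

theorem contDiff_flow (lam : ℝ) : ContDiff ℝ ∞ fun x : (ℂ × ℂ) × ℂ => flow lam x.2 x.1 := by
  unfold flow
  have h : ContDiff ℝ ∞ Complex.exp := Complex.contDiff_exp
  exact ((h.comp contDiff_snd).mul (contDiff_fst.comp contDiff_fst)).prodMk
    ((h.comp (contDiff_const.mul contDiff_snd)).mul (contDiff_snd.comp contDiff_fst))

/-- Test functions only need leafwise smoothness, but all those constructed below are smooth on
`ℂ²`. -/
theorem isTest_of_contDiff {lam : ℝ} {f : ℂ × ℂ → ℝ} (hf : ContDiff ℝ ∞ f)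
    (hc : HasCompactSupport f) (hs : tsupport f ⊆ regularPart) : IsTest lam f where
  compact := hc
  support := hs
  smooth _ := hf.comp ((contDiff_flow lam).comp (contDiff_const.prodMk contDiff_id))
  cont n := continuous_iteratedFDeriv_partial (hf.comp (contDiff_flow lam)) n

/-- If `f` depends only on `Re ζ` along the leaf through `p`, then `∂²f/∂ζ∂ζ̄` is a quarter of the
second derivative in `Re ζ`. -/
theorem ddbar_apply_of_re {lam : ℝ} (f : TestFunction lam) (p : ℂ × ℂ) {γ γ' : ℝ → ℝ} {d : ℝ}
    (h : ∀ ζ, alongLeaf lam f.1 p ζ = γ ζ.re) (h1 : ∀ u, HasDerivAt γ (γ' u) u)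
    (h2 : HasDerivAt γ' d 0) : (ddbar f).1 p = 1 / 4 * d := by
  have e1 : ∀ v ζ : ℂ, fderiv ℝ (alongLeaf lam f.1 p) ζ v = γ' ζ.re * v.re := by
    intro v ζ
    have : HasFDerivAt (alongLeaf lam f.1 p) (γ' ζ.re • Complex.reCLM) ζ := by
      rw [show alongLeaf lam f.1 p = γ ∘ Complex.reCLM from funext h]
      exact HasDerivAt.comp_hasFDerivAt ζ (h1 ζ.re) Complex.reCLM.hasFDerivAt
    rw [this.fderiv]
    simp
  have e2 : ∀ v : ℂ, leafDeriv lam v (leafDeriv lam v f.1) p = d * v.re * v.re := by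
    intro v
    rw [leafDeriv, alongLeaf_leafDeriv]
    simp only [e1]
    have h2' : HasDerivAt γ' d (Complex.reCLM 0) := by simpa using h2
    have : HasFDerivAt (fun ζ : ℂ => γ' ζ.re * v.re) (v.re • (d • Complex.reCLM)) 0 :=
      (HasDerivAt.comp_hasFDerivAt (0 : ℂ) h2' Complex.reCLM.hasFDerivAt).mul_const v.re
    rw [this.fderiv]
    simp; ring
  simp [ddbar, e2]

/-! ### Positivity and mass -/

theorem DirectedHarmonicCurrent.apply_mono {lam : ℝ} (T : DirectedHarmonicCurrent lam)
    {φ ψ : TestForm lam} (h : ∀ p, φ.1 p ≤ ψ.1 p) : T.toLinearMap φ ≤ T.toLinearMap ψ := by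
  have := T.positive (ψ - φ) fun p => sub_nonneg.2 (h p)
  rw [map_sub] at this
  linarith

theorem DirectedHarmonicCurrent.apply_le_of_mass_lt {lam : ℝ} (T : DirectedHarmonicCurrent lam)
    {U : Set (ℂ × ℂ)} {C η : ℝ} (hC : 0 < C) (hη : 0 ≤ η) (hU : T.mass U < ENNReal.ofReal η)
    (φ : TestForm lam) (h : ∀ p, 0 ≤ φ.1 p ∧ φ.1 p ≤ C * kahlerCoeff lam p)
    (hs : tsupport φ.1 ⊆ U) : T.toLinearMap φ ≤ C * η := by
  have h1 : ENNReal.ofReal (T.toLinearMap (C⁻¹ • φ)) ≤ T.mass U := by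
    refine le_iSup_of_le (C⁻¹ • φ) (le_iSup_of_le (fun p => ?_) (le_iSup_of_le ?_ le_rfl))
    · have e : (C⁻¹ • φ).1 p = C⁻¹ * φ.1 p := rfl
      rw [e]
      exact ⟨mul_nonneg (inv_nonneg.2 hC.le) (h p).1, (inv_mul_le_iff₀ hC).2 (h p).2⟩
    · exact (closure_mono (Function.support_const_smul_subset C⁻¹ φ.1)).trans hs
  have h2 := (ENNReal.ofReal_le_ofReal_iff hη).1 (h1.trans hU.le)
  rw [map_smul, smul_eq_mul, inv_mul_le_iff₀ hC] at h2
  exact h2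

theorem DirectedHarmonicCurrent.NoMassOn.exists_isOpen {lam : ℝ}
    {T : DirectedHarmonicCurrent lam} {S : Set (ℂ × ℂ)} (h : T.NoMassOn S) {η : ℝ} (hη : 0 < η) :
    ∃ U, IsOpen U ∧ S ⊆ U ∧ T.mass U < ENNReal.ofReal η := by
  have h' : (⨅ (U : Set (ℂ × ℂ)) (_ : IsOpen U) (_ : S ⊆ U), T.mass U) < ENNReal.ofReal η := by
    rw [show (⨅ (U : Set (ℂ × ℂ)) (_ : IsOpen U) (_ : S ⊆ U), T.mass U) = 0 from h]
    exact ENNReal.ofReal_pos.2 hη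
  simpa only [iInf_lt_iff, exists_prop] using h'

/-! ### The leafwise constant level function -/

/-- The function `|z|^{-lam} |w|`, which is constant on each leaf. As `lam < 0`, it is continuous on
`ℂ²` and its zero set is the union of the two separatrices. -/
noncomputable def level (lam : ℝ) (p : ℂ × ℂ) : ℝ := ‖p.1‖ ^ (-lam) * ‖p.2‖

theorem continuous_level {lam : ℝ} (hlam : lam < 0) : Continuous (level lam) := by
  unfold level
  exact (continuous_fst.norm.rpow_const fun _ => Or.inr (by linarith)).mul continuous_snd.norm

theorem norm_flow_fst (lam : ℝ) (ζ : ℂ) (p : ℂ × ℂ) :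
    ‖(flow lam ζ p).1‖ = Real.exp ζ.re * ‖p.1‖ := by
  simp [flow, Complex.norm_exp]

theorem norm_flow_snd (lam : ℝ) (ζ : ℂ) (p : ℂ × ℂ) :
    ‖(flow lam ζ p).2‖ = Real.exp (lam * ζ.re) * ‖p.2‖ := by
  simp [flow, Complex.norm_exp]

theorem level_flow (lam : ℝ) (ζ : ℂ) (p : ℂ × ℂ) : level lam (flow lam ζ p) = level lam p := by
  rw [level, norm_flow_fst, norm_flow_snd, Real.mul_rpow (Real.exp_pos _).le (norm_nonneg _),
    ← Real.exp_mul, level]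
  have : Real.exp (ζ.re * -lam) * Real.exp (lam * ζ.re) = 1 := by
    rw [← Real.exp_add]; simp; ring
  linear_combination ‖p.1‖ ^ (-lam) * ‖p.2‖ * this

theorem level_pos_iff {lam : ℝ} (hlam : lam < 0) (p : ℂ × ℂ) :
    0 < level lam p ↔ p.1 ≠ 0 ∧ p.2 ≠ 0 := by
  constructor
  · intro h
    refine ⟨fun h0 => ?_, fun h0 => ?_⟩
    · rw [level, h0, norm_zero, Real.zero_rpow (by linarith), zero_mul] at h
      exact h.false
    · rw [level, h0, norm_zero, mul_zero] at h
      exact h.false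
  · rintro ⟨h1, h2⟩
    exact mul_pos (Real.rpow_pos_of_pos (norm_pos_iff.2 h1) _) (norm_pos_iff.2 h2)

/-- Smooth cutoff in the invariant `level`: it is `1` on `{s₀ ≤ level ≤ s₁}` and vanishes off
`{s₀ / 2 < level < 2 s₁}`. -/
noncomputable def levelCutoff (lam s₀ s₁ : ℝ) (p : ℂ × ℂ) : ℝ :=
  Real.smoothTransition (2 * level lam p / s₀ - 1) * Real.smoothTransition (2 - level lam p / s₁)

theorem levelCutoff_nonneg (lam s₀ s₁ : ℝ) (p : ℂ × ℂ) : 0 ≤ levelCutoff lam s₀ s₁ p :=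
  mul_nonneg (Real.smoothTransition.nonneg _) (Real.smoothTransition.nonneg _)

theorem levelCutoff_le_one (lam s₀ s₁ : ℝ) (p : ℂ × ℂ) : levelCutoff lam s₀ s₁ p ≤ 1 :=
  mul_le_one₀ (Real.smoothTransition.le_one _) (Real.smoothTransition.nonneg _)
    (Real.smoothTransition.le_one _)

theorem levelCutoff_flow (lam s₀ s₁ : ℝ) (ζ : ℂ) (p : ℂ × ℂ) :
    levelCutoff lam s₀ s₁ (flow lam ζ p) = levelCutoff lam s₀ s₁ p := by
  rw [levelCutoff, level_flow, levelCutoff]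

theorem levelCutoff_eq_one {lam s₀ s₁ : ℝ} {p : ℂ × ℂ} (h₀ : 0 < s₀) (h₁ : 0 < s₁)
    (h : s₀ ≤ level lam p) (h' : level lam p ≤ s₁) : levelCutoff lam s₀ s₁ p = 1 := by
  have a : 1 ≤ level lam p / s₀ := (one_le_div h₀).2 h
  have b : level lam p / s₁ ≤ 1 := (div_le_one h₁).2 h'
  rw [levelCutoff, Real.smoothTransition.one_of_one_le (by rw [mul_div_assoc]; linarith),
    Real.smoothTransition.one_of_one_le (by linarith), one_mul]

theorem level_of_levelCutoff_ne_zero {lam s₀ s₁ : ℝ} {p : ℂ × ℂ} (h₀ : 0 < s₀) (h₁ : 0 < s₁)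
    (h : levelCutoff lam s₀ s₁ p ≠ 0) : s₀ / 2 ≤ level lam p ∧ level lam p ≤ 2 * s₁ := by
  constructor
  · by_contra! hlt
    refine left_ne_zero_of_mul h (Real.smoothTransition.zero_of_nonpos ?_)
    have : 2 * level lam p / s₀ ≤ 1 := (div_le_one h₀).2 (by linarith)
    linarith
  · by_contra! hlt
    refine right_ne_zero_of_mul h (Real.smoothTransition.zero_of_nonpos ?_)
    have : 2 ≤ level lam p / s₁ := (le_div_iff₀ h₁).2 hlt.le
    linarith

theorem contDiff_levelCutoff {lam s₀ : ℝ} (hlam : lam < 0) (h₀ : 0 < s₀) {s₁ : ℝ} (h₁ : 0 < s₁) :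
    ContDiff ℝ ∞ (levelCutoff lam s₀ s₁) := by
  rw [contDiff_iff_contDiffAt]
  intro p
  by_cases hp : p.1 ≠ 0 ∧ p.2 ≠ 0
  · have hl : ContDiffAt ℝ ∞ (level lam) p := by
      unfold level
      exact ((contDiff_fst.contDiffAt.norm ℝ hp.1).rpow_const_of_ne (norm_ne_zero_iff.2 hp.1)).mul
        (contDiff_snd.contDiffAt.norm ℝ hp.2)
    unfold levelCutoff
    refine ContDiffAt.mul ?_ ?_
    · exact (Real.smoothTransition.contDiff.contDiffAt).comp p
        (((contDiffAt_const.mul hl).div_const _).sub contDiffAt_const)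
    · exact (Real.smoothTransition.contDiff.contDiffAt).comp p
        (contDiffAt_const.sub (hl.div_const _))
  · -- on the separatrices the level is `0`, so the cutoff vanishes nearby
    have hl : level lam p < s₀ / 2 := by
      rw [← level_pos_iff hlam, not_lt] at hp
      linarith
    have : levelCutoff lam s₀ s₁ =ᶠ[𝓝 p] fun _ => 0 := by
      filter_upwards [(continuous_level hlam).continuousAt.eventually (gt_mem_nhds hl)] with x hx
      by_contra hne
      exact absurd (level_of_levelCutoff_ne_zero h₀ h₁ hne).1 (not_le.2 hx)
    exact contDiffAt_const.congr_of_eventuallyEq this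

/-! ### Supports in the regular part -/

theorem isTest_of_support_subset {lam : ℝ} {f : ℂ × ℂ → ℝ} (hf : ContDiff ℝ ∞ f)
    {S : Set (ℂ × ℂ)} (hc : IsCompact S) (hS : S ⊆ regularPart) (h : ∀ p, f p ≠ 0 → p ∈ S) :
    IsTest lam f ∧ tsupport f ⊆ S := by
  have hs : tsupport f ⊆ S := closure_minimal h hc.isClosed
  exact ⟨isTest_of_contDiff hf (hc.of_isClosed_subset (isClosed_tsupport f) hs) (hs.trans hS), hs⟩

theorem isCompact_of_isClosed_of_norm_le {S : Set (ℂ × ℂ)} (hS : IsClosed S) {ρ : ℝ}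
    (h : ∀ p ∈ S, ‖p.1‖ ≤ ρ ∧ ‖p.2‖ ≤ ρ) : IsCompact S :=
  Metric.isCompact_of_isClosed_isBounded hS <| (isBounded_iff_forall_norm_le).2
    ⟨ρ, fun p hp => norm_prod_le_iff.2 (h p hp)⟩

theorem mem_regularPart_of_level_pos {lam : ℝ} (hlam : lam < 0) {p : ℂ × ℂ}
    (h : 0 < level lam p) (h1 : ‖p.1‖ < 1) (h2 : ‖p.2‖ < 1) : p ∈ regularPart := by
  refine ⟨⟨h1, h2⟩, fun h0 => ((level_pos_iff hlam p).1 h).1 ?_⟩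
  rw [Set.mem_singleton_iff] at h0
  rw [h0, Prod.fst_zero]

/-! ### The logarithmic potential -/

/-- A smooth truncation of the identity: `q t = t` for `t < -2` and `q t = 0` for `t ≥ -1`. -/
theorem exists_smooth_truncation : ∃ (q : ℝ → ℝ) (M : ℝ), ContDiff ℝ ∞ q ∧ 0 < M ∧
    (∀ t, -1 ≤ t → q t = 0) ∧ (∀ t, t < -2 → deriv q t = 1 ∧ deriv (deriv q) t = 0) ∧
    (∀ t, -1 < t → deriv q t = 0 ∧ deriv (deriv q) t = 0) ∧
    ∀ t, -2 ≤ t → t ≤ -1 → |deriv q t| ≤ M ∧ |deriv (deriv q) t| ≤ M := by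
  let q : ℝ → ℝ := fun t => t * Real.smoothTransition (-1 - t)
  have hq : ContDiff ℝ ∞ q := contDiff_id.mul
    (Real.smoothTransition.contDiff.comp (contDiff_const.sub contDiff_id))
  have hq1 : ContDiff ℝ ∞ (deriv q) := (contDiff_infty_iff_deriv.1 hq).2
  have hq2 : ContDiff ℝ ∞ (deriv (deriv q)) := (contDiff_infty_iff_deriv.1 hq1).2
  obtain ⟨M₁, hM₁⟩ := (isCompact_Icc (a := (-2 : ℝ)) (b := -1)).exists_bound_of_continuousOn
    hq1.continuous.continuousOn
  obtain ⟨M₂, hM₂⟩ := (isCompact_Icc (a := (-2 : ℝ)) (b := -1)).exists_bound_of_continuousOn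
    hq2.continuous.continuousOn
  have h0 : ∀ t, -1 ≤ t → q t = 0 := fun t ht => by
    simp only [q]
    rw [Real.smoothTransition.zero_of_nonpos (by linarith), mul_zero]
  refine ⟨q, max 1 (max M₁ M₂), hq, by positivity, h0, fun t ht => ?_, fun t ht => ?_,
    fun t h h' => ⟨?_, ?_⟩⟩
  · have e : q =ᶠ[𝓝 t] id := by
      filter_upwards [gt_mem_nhds ht] with x hx
      simp only [q, id]
      rw [Real.smoothTransition.one_of_one_le (by linarith), mul_one]
    refine ⟨by rw [e.deriv_eq, deriv_id], ?_⟩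
    rw [e.deriv.deriv_eq]
    simp
  · have e : q =ᶠ[𝓝 t] fun _ => 0 := by
      filter_upwards [lt_mem_nhds ht] with x hx using h0 x hx.le
    refine ⟨by rw [e.deriv_eq, deriv_const], ?_⟩
    rw [e.deriv.deriv_eq]
    simp
  · exact (hM₁ t ⟨h, h'⟩).trans ((le_max_left _ _).trans (le_max_right _ _))
  · exact (hM₂ t ⟨h, h'⟩).trans ((le_max_right _ _).trans (le_max_right _ _))

/-- The potential `log ((r² + |z|²)(r² + |w|²) / r²)`. Along a leaf it is a convex function of
`Re ζ`, with first and second derivatives bounded independently of `r`. The normalization by `r²`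
makes it close to `log |z|²` where `|z| ≫ r ≫ |w|`, and to `log |w|²` where `|w| ≫ r ≫ |z|`; hence
it is bounded near the boundary of the bidisc, uniformly in `r`, on leaves of small level. -/
noncomputable def logPotential (r : ℝ) (p : ℂ × ℂ) : ℝ :=
  Real.log ((r ^ 2 + ‖p.1‖ ^ 2) * (r ^ 2 + ‖p.2‖ ^ 2) / r ^ 2)

theorem logPotential_arg_pos {r : ℝ} (hr : 0 < r) (p : ℂ × ℂ) :
    0 < (r ^ 2 + ‖p.1‖ ^ 2) * (r ^ 2 + ‖p.2‖ ^ 2) / r ^ 2 := by positivity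

theorem contDiff_logPotential {r : ℝ} (hr : 0 < r) : ContDiff ℝ ∞ (logPotential r) := by
  unfold logPotential
  refine ContDiff.log (((contDiff_const.add ?_).mul (contDiff_const.add ?_)).div_const _)
    fun p => (logPotential_arg_pos hr p).ne'
  · exact contDiff_fst.norm_sq ℝ
  · exact contDiff_snd.norm_sq ℝ

theorem sq_norm_fst_le_exp_logPotential {r : ℝ} (hr : 0 < r) (p : ℂ × ℂ) :
    ‖p.1‖ ^ 2 ≤ Real.exp (logPotential r p) := by
  rw [logPotential, Real.exp_log (logPotential_arg_pos hr p), le_div_iff₀ (by positivity)]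
  nlinarith [sq_nonneg r, mul_nonneg (sq_nonneg ‖p.1‖) (sq_nonneg ‖p.2‖),
    mul_nonneg (sq_nonneg r) (sq_nonneg ‖p.2‖)]

theorem sq_norm_snd_le_exp_logPotential {r : ℝ} (hr : 0 < r) (p : ℂ × ℂ) :
    ‖p.2‖ ^ 2 ≤ Real.exp (logPotential r p) := by
  rw [logPotential, Real.exp_log (logPotential_arg_pos hr p), le_div_iff₀ (by positivity)]
  nlinarith [sq_nonneg r, mul_nonneg (sq_nonneg ‖p.1‖) (sq_nonneg ‖p.2‖),
    mul_nonneg (sq_nonneg r) (sq_nonneg ‖p.1‖)]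

theorem exp_neg_one_le : Real.exp (-1) ≤ 1 / 2 := by
  rw [Real.exp_neg, inv_le_comm₀ (Real.exp_pos _) (by norm_num)]
  linarith [Real.add_one_le_exp (1 : ℝ)]

theorem le_exp_neg_two : 1 / 8 ≤ Real.exp (-2) := by
  rw [Real.exp_neg, le_inv_comm₀ (by norm_num) (Real.exp_pos _),
    show (2 : ℝ) = 1 + 1 by norm_num, Real.exp_add]
  nlinarith [Real.exp_one_lt_d9, Real.exp_pos 1]

theorem logPotential_lt_of_mem_bidisc {r : ℝ} (hr : 0 < r) (hr' : r ^ 2 ≤ 1 / 80) {p : ℂ × ℂ}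
    (hp : p ∈ bidisc r) : logPotential r p < -2 := by
  have h1 : ‖p.1‖ ^ 2 ≤ r ^ 2 := pow_le_pow_left₀ (norm_nonneg _) hp.1.le 2
  have h2 : ‖p.2‖ ^ 2 ≤ r ^ 2 := pow_le_pow_left₀ (norm_nonneg _) hp.2.le 2
  rw [logPotential, Real.log_lt_iff_lt_exp (logPotential_arg_pos hr p)]
  refine lt_of_le_of_lt ?_ (lt_of_lt_of_le (by norm_num : (1 / 20 : ℝ) < 1 / 8) le_exp_neg_two)
  rw [div_le_iff₀ (by positivity)]
  have := mul_le_mul (add_le_add_right h1 (r ^ 2)) (add_le_add_right h2 (r ^ 2))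
    (by positivity) (by positivity)
  nlinarith [sq_nonneg r]

theorem level_le_of_mem_bidisc {lam : ℝ} (hlam : lam < 0) {r : ℝ} (hr : 0 < r) {p : ℂ × ℂ}
    (hp : p ∈ bidisc r) : level lam p ≤ r ^ (1 - lam) := by
  rw [level, show 1 - lam = -lam + 1 by ring, Real.rpow_add hr, Real.rpow_one]
  exact mul_le_mul (Real.rpow_le_rpow (norm_nonneg _) hp.1.le (by linarith)) hp.2.le
    (norm_nonneg _) (by positivity)

/-- On leaves of level at most `2 r^{1 - lam}`, the points where the potential is neither small nor
large are at a definite distance from one of the separatrices. -/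
theorem le_sq_norm_or_le_sq_norm {lam : ℝ} (hlam : lam < 0) {r : ℝ} (hr : 0 < r)
    (hr' : r ^ 2 ≤ 1 / 80) {p : ℂ × ℂ} (hl : level lam p ≤ 2 * r ^ (1 - lam))
    (hV : -2 ≤ logPotential r p) : 1 / 80 ≤ ‖p.1‖ ^ 2 ∨ 1 / 80 ≤ ‖p.2‖ ^ 2 := by
  have hN : 1 / 8 * r ^ 2 ≤ (r ^ 2 + ‖p.1‖ ^ 2) * (r ^ 2 + ‖p.2‖ ^ 2) := by
    rw [logPotential, Real.le_log_iff_exp_le (logPotential_arg_pos hr p)] at hV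
    exact (le_div_iff₀ (by positivity)).1 (le_exp_neg_two.trans hV)
  have hr2 : 0 < r ^ 2 := by positivity
  rcases le_total r ‖p.1‖ with h | h
  · left
    have h2 : ‖p.2‖ ≤ 2 * r := by
      have h3 : r ^ (-lam) * ‖p.2‖ ≤ r ^ (-lam) * (2 * r) := by
        refine (mul_le_mul_of_nonneg_right (Real.rpow_le_rpow hr.le h (by linarith))
          (norm_nonneg _)).trans (hl.trans (le_of_eq ?_))
        rw [show 1 - lam = -lam + 1 by ring, Real.rpow_add hr, Real.rpow_one]
        ring
      exact le_of_mul_le_mul_left h3 (by positivity)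
    have h4 : ‖p.2‖ ^ 2 ≤ 4 * r ^ 2 := by nlinarith [norm_nonneg p.2]
    have h5 : (r ^ 2 + ‖p.1‖ ^ 2) * (r ^ 2 + ‖p.2‖ ^ 2) ≤ (r ^ 2 + ‖p.1‖ ^ 2) * (5 * r ^ 2) :=
      mul_le_mul_of_nonneg_left (by linarith) (by positivity)
    have h6 : 1 / 8 ≤ (r ^ 2 + ‖p.1‖ ^ 2) * 5 :=
      le_of_mul_le_mul_right (by linarith) hr2
    linarith
  · right
    have h4 : ‖p.1‖ ^ 2 ≤ r ^ 2 := pow_le_pow_left₀ (norm_nonneg _) h 2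
    have h5 : (r ^ 2 + ‖p.1‖ ^ 2) * (r ^ 2 + ‖p.2‖ ^ 2) ≤ (2 * r ^ 2) * (r ^ 2 + ‖p.2‖ ^ 2) :=
      mul_le_mul_of_nonneg_right (by linarith) (by positivity)
    have h6 : 1 / 8 ≤ 2 * (r ^ 2 + ‖p.2‖ ^ 2) :=
      le_of_mul_le_mul_right (by linarith) hr2
    linarith

theorem hasDerivAt_log_add_mul_exp {R X : ℝ} (hR : 0 < R) (hX : 0 ≤ X) (c u : ℝ) :
    HasDerivAt (fun u => Real.log (R + X * Real.exp (c * u)))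
      (c * (X * Real.exp (c * u)) / (R + X * Real.exp (c * u))) u := by
  have h : HasDerivAt (fun u => R + X * Real.exp (c * u)) (c * (X * Real.exp (c * u))) u := by
    have := ((((hasDerivAt_id u).const_mul c).exp).const_mul X).const_add R
    simp only [id, mul_one] at this
    exact this.congr_deriv (by ring)
  exact h.log (by positivity)

theorem hasDerivAt_deriv_log_add_mul_exp {R X : ℝ} (hR : 0 < R) (hX : 0 ≤ X) (c : ℝ) :
    HasDerivAt (fun u => c * (X * Real.exp (c * u)) / (R + X * Real.exp (c * u)))
      (c ^ 2 * R * X / (R + X) ^ 2) 0 := by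
  have h : HasDerivAt (fun u => X * Real.exp (c * u)) (c * X) 0 := by
    have := (((hasDerivAt_id (0 : ℝ)).const_mul c).exp).const_mul X
    simp only [id, mul_one, mul_zero, Real.exp_zero, one_mul] at this
    exact this.congr_deriv (by ring)
  have h' := (h.const_mul c).div (h.const_add R) (by positivity)
  simp only [mul_zero, Real.exp_zero, mul_one] at h'
  exact h'.congr_deriv (by ring)

/-- First derivative of `logPotential` at `p` along the leaf, in the direction `Re ζ`. -/
noncomputable def logPotentialDeriv (lam r : ℝ) (p : ℂ × ℂ) : ℝ :=
  2 * ‖p.1‖ ^ 2 / (r ^ 2 + ‖p.1‖ ^ 2) + 2 * lam * ‖p.2‖ ^ 2 / (r ^ 2 + ‖p.2‖ ^ 2)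

/-- Second derivative of `logPotential` at `p` along the leaf, in the direction `Re ζ`. -/
noncomputable def logPotentialDeriv₂ (lam r : ℝ) (p : ℂ × ℂ) : ℝ :=
  4 * r ^ 2 * ‖p.1‖ ^ 2 / (r ^ 2 + ‖p.1‖ ^ 2) ^ 2 +
    4 * lam ^ 2 * r ^ 2 * ‖p.2‖ ^ 2 / (r ^ 2 + ‖p.2‖ ^ 2) ^ 2

theorem sq_logPotentialDeriv_le {lam r : ℝ} (hlam : lam < 0) (hr : 0 < r) (p : ℂ × ℂ) :
    logPotentialDeriv lam r p ^ 2 ≤ 4 * (1 - lam) ^ 2 := by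
  have h : ∀ X : ℝ, 0 ≤ X → 0 ≤ X / (r ^ 2 + X) ∧ X / (r ^ 2 + X) ≤ 1 := fun X hX =>
    ⟨by positivity, (div_le_one (by positivity)).2 (by nlinarith [sq_nonneg r])⟩
  have h1 := h (‖p.1‖ ^ 2) (sq_nonneg _)
  have h2 := h (‖p.2‖ ^ 2) (sq_nonneg _)
  rw [show 4 * (1 - lam) ^ 2 = (2 * (1 - lam)) ^ 2 by ring]
  refine sq_le_sq' ?_ ?_ <;> rw [logPotentialDeriv, mul_div_assoc, mul_div_assoc] <;> nlinarith

theorem logPotentialDeriv₂_nonneg (lam r : ℝ) (p : ℂ × ℂ) :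
    0 ≤ logPotentialDeriv₂ lam r p := by unfold logPotentialDeriv₂; positivity

theorem logPotentialDeriv₂_le {lam r : ℝ} (hlam : lam < 0) (hr : 0 < r) (p : ℂ × ℂ) :
    logPotentialDeriv₂ lam r p ≤ (1 - lam) ^ 2 := by
  have h : ∀ X : ℝ, 0 ≤ X → 4 * r ^ 2 * X / (r ^ 2 + X) ^ 2 ≤ 1 := fun X hX =>
    (div_le_one (by positivity)).2 (by nlinarith [sq_nonneg (r ^ 2 - X)])
  have h1 := h (‖p.1‖ ^ 2) (sq_nonneg _)
  have h2 := mul_le_mul_of_nonneg_left (h (‖p.2‖ ^ 2) (sq_nonneg _)) (sq_nonneg lam)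
  have e : lam ^ 2 * (4 * r ^ 2 * ‖p.2‖ ^ 2 / (r ^ 2 + ‖p.2‖ ^ 2) ^ 2) =
    4 * lam ^ 2 * r ^ 2 * ‖p.2‖ ^ 2 / (r ^ 2 + ‖p.2‖ ^ 2) ^ 2 := by ring
  rw [e] at h2
  rw [logPotentialDeriv₂]
  nlinarith

theorem kahlerCoeff_eq (lam : ℝ) (p : ℂ × ℂ) :
    kahlerCoeff lam p = ‖p.1‖ ^ 2 + lam ^ 2 * ‖p.2‖ ^ 2 := by
  simp [kahlerCoeff, vectorField, mul_pow]

/-- On the bidisc of radius `r`, `r²` times the second derivative dominates the Kähler form. -/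
theorem kahlerCoeff_le_of_mem_bidisc (lam : ℝ) {r : ℝ} (hr : 0 < r) {p : ℂ × ℂ}
    (hp : p ∈ bidisc r) : kahlerCoeff lam p ≤ r ^ 2 * logPotentialDeriv₂ lam r p := by
  have h : ∀ X : ℝ, 0 ≤ X → X ≤ r ^ 2 → X ≤ r ^ 2 * (4 * r ^ 2 * X / (r ^ 2 + X) ^ 2) := by
    intro X hX hX'
    rw [← mul_div_assoc, le_div_iff₀ (by positivity)]
    have : (r ^ 2 + X) ^ 2 ≤ (2 * r ^ 2) ^ 2 := pow_le_pow_left₀ (by positivity) (by linarith) 2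
    nlinarith [mul_le_mul_of_nonneg_left this hX]
  have h1 := h (‖p.1‖ ^ 2) (sq_nonneg _) (pow_le_pow_left₀ (norm_nonneg _) hp.1.le 2)
  have h2 := mul_le_mul_of_nonneg_left
    (h (‖p.2‖ ^ 2) (sq_nonneg _) (pow_le_pow_left₀ (norm_nonneg _) hp.2.le 2)) (sq_nonneg lam)
  rw [kahlerCoeff_eq, logPotentialDeriv₂, mul_add]
  refine add_le_add h1 (h2.trans (le_of_eq ?_))
  ring

/-! ### The comparison function -/

/-- The function `r² χ q(V)`, with `χ` the level cutoff, `V` the logarithmic potential and `q` a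
truncation. -/
noncomputable def comparison (lam r s₀ s₁ : ℝ) (q : ℝ → ℝ) (p : ℂ × ℂ) : ℝ :=
  r ^ 2 * (levelCutoff lam s₀ s₁ p * q (logPotential r p))

theorem isTest_comparison {lam : ℝ} (hlam : lam < 0) {r s₀ s₁ : ℝ} (hr : 0 < r) (h₀ : 0 < s₀)
    (h₁ : 0 < s₁) {q : ℝ → ℝ} (hq : ContDiff ℝ ∞ q) (hq0 : ∀ t, -1 ≤ t → q t = 0) :
    IsTest lam (comparison lam r s₀ s₁ q) := by
  let S : Set (ℂ × ℂ) := {p | s₀ / 2 ≤ level lam p ∧ ‖p.1‖ ≤ 7 / 8 ∧ ‖p.2‖ ≤ 7 / 8}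
  have hS : IsClosed S := (isClosed_le continuous_const (continuous_level hlam)).inter
    ((isClosed_le continuous_fst.norm continuous_const).inter
      (isClosed_le continuous_snd.norm continuous_const))
  refine (isTest_of_support_subset ?_ (isCompact_of_isClosed_of_norm_le hS fun p hp => hp.2)
    (fun p hp => ?_) fun p hp => ?_).1
  · exact contDiff_const.mul
      ((contDiff_levelCutoff hlam h₀ h₁).mul (hq.comp (contDiff_logPotential hr)))
  · exact mem_regularPart_of_level_pos hlam (by linarith [hp.1])
      (by linarith [hp.2.1]) (by linarith [hp.2.2])
  · have hp' := right_ne_zero_of_mul hp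
    have hV : logPotential r p ≤ -1 := by
      by_contra! hlt
      exact right_ne_zero_of_mul hp' (hq0 _ hlt.le)
    have hV' := (Real.exp_le_exp.2 hV).trans exp_neg_one_le
    refine ⟨(level_of_levelCutoff_ne_zero h₀ h₁ (left_ne_zero_of_mul hp')).1, ?_, ?_⟩
    · exact abs_le_of_sq_le_sq' (by linarith [sq_norm_fst_le_exp_logPotential hr p])
        (by norm_num) |>.2
    · exact abs_le_of_sq_le_sq' (by linarith [sq_norm_snd_le_exp_logPotential hr p])
        (by norm_num) |>.2

theorem ddbar_comparison {lam r s₀ s₁ : ℝ} (hr : 0 < r) {q : ℝ → ℝ} (hq : ContDiff ℝ ∞ q)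
    (hF : IsTest lam (comparison lam r s₀ s₁ q)) (p : ℂ × ℂ) :
    (ddbar (⟨comparison lam r s₀ s₁ q, hF⟩ : TestFunction lam)).1 p =
      1 / 4 * (r ^ 2 * (levelCutoff lam s₀ s₁ p *
        (deriv (deriv q) (logPotential r p) * logPotentialDeriv lam r p ^ 2 +
          deriv q (logPotential r p) * logPotentialDeriv₂ lam r p))) := by
  have hr2 : 0 < r ^ 2 := by positivity
  have hq1 : ContDiff ℝ ∞ (deriv q) := (contDiff_infty_iff_deriv.1 hq).2
  have dq : ∀ t, HasDerivAt q (deriv q t) t := fun t =>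
    ((contDiff_infty_iff_deriv.1 hq).1 t).hasDerivAt
  have dq1 : ∀ t, HasDerivAt (deriv q) (deriv (deriv q) t) t := fun t =>
    ((contDiff_infty_iff_deriv.1 hq1).1 t).hasDerivAt
  set X := ‖p.1‖ ^ 2 with hX
  set Y := ‖p.2‖ ^ 2 with hY
  have hX0 : 0 ≤ X := sq_nonneg _
  have hY0 : 0 ≤ Y := sq_nonneg _
  let v : ℝ → ℝ := fun u => Real.log (r ^ 2 + X * Real.exp (2 * u)) +
    Real.log (r ^ 2 + Y * Real.exp (2 * lam * u)) - Real.log (r ^ 2)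
  let v' : ℝ → ℝ := fun u => 2 * (X * Real.exp (2 * u)) / (r ^ 2 + X * Real.exp (2 * u)) +
    2 * lam * (Y * Real.exp (2 * lam * u)) / (r ^ 2 + Y * Real.exp (2 * lam * u))
  have hv : ∀ u, HasDerivAt v (v' u) u := fun u =>
    ((hasDerivAt_log_add_mul_exp hr2 hX0 2 u).add
      (hasDerivAt_log_add_mul_exp hr2 hY0 (2 * lam) u)).sub_const _
  have hv' : HasDerivAt v' (logPotentialDeriv₂ lam r p) 0 :=
    ((hasDerivAt_deriv_log_add_mul_exp hr2 hX0 2).add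
      (hasDerivAt_deriv_log_add_mul_exp hr2 hY0 (2 * lam))).congr_deriv (by
        rw [logPotentialDeriv₂]; ring)
  have hV : ∀ ζ : ℂ, logPotential r (flow lam ζ p) = v ζ.re := by
    intro ζ
    have e1 : ‖(flow lam ζ p).1‖ ^ 2 = X * Real.exp (2 * ζ.re) := by
      rw [norm_flow_fst, mul_pow, ← Real.exp_nat_mul, mul_comm]; norm_num [hX]
    have e2 : ‖(flow lam ζ p).2‖ ^ 2 = Y * Real.exp (2 * lam * ζ.re) := by
      rw [norm_flow_snd, mul_pow, ← Real.exp_nat_mul, mul_comm]; norm_num [mul_assoc, hY]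
    rw [logPotential, e1, e2, Real.log_div (by positivity) (by positivity),
      Real.log_mul (by positivity) (by positivity)]
  have hV0 : v 0 = logPotential r p := by
    have := hV 0
    rw [flow_zero] at this
    exact this.symm
  have hv0 : v' 0 = logPotentialDeriv lam r p := by
    simp only [v', mul_zero, Real.exp_zero, mul_one, logPotentialDeriv, hX, hY]
  set c := levelCutoff lam s₀ s₁ p with hc
  refine ddbar_apply_of_re _ p (γ := fun u => r ^ 2 * (c * q (v u)))
    (γ' := fun u => r ^ 2 * (c * (deriv q (v u) * v' u))) (fun ζ => ?_) (fun u => ?_) ?_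
  · simp only [alongLeaf, comparison, levelCutoff_flow, hV, hc]
  · exact (((dq (v u)).comp u (hv u)).const_mul c).const_mul (r ^ 2)
  · have h := ((((dq1 (v 0)).comp 0 (hv 0)).mul hv').const_mul c).const_mul (r ^ 2)
    simp only [Function.comp] at h
    rw [hV0, hv0] at h
    exact h.congr_deriv (by ring)

/-- Smooth bump function: `1` on `[1 / 80, 1 / 2]` and zero off `[1 / 160, 3 / 4]`. -/
noncomputable def annulusBump (x : ℝ) : ℝ :=
  Real.smoothTransition (160 * x - 1) * Real.smoothTransition (3 - 4 * x)

theorem contDiff_annulusBump : ContDiff ℝ ∞ annulusBump :=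
  (Real.smoothTransition.contDiff.comp ((contDiff_const.mul contDiff_id).sub contDiff_const)).mul
    (Real.smoothTransition.contDiff.comp (contDiff_const.sub (contDiff_const.mul contDiff_id)))

theorem annulusBump_nonneg (x : ℝ) : 0 ≤ annulusBump x :=
  mul_nonneg (Real.smoothTransition.nonneg _) (Real.smoothTransition.nonneg _)

theorem annulusBump_le_one (x : ℝ) : annulusBump x ≤ 1 :=
  mul_le_one₀ (Real.smoothTransition.le_one _) (Real.smoothTransition.nonneg _)
    (Real.smoothTransition.le_one _)

theorem annulusBump_eq_one {x : ℝ} (h : 1 / 80 ≤ x) (h' : x ≤ 1 / 2) : annulusBump x = 1 := by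
  rw [annulusBump, Real.smoothTransition.one_of_one_le (by linarith),
    Real.smoothTransition.one_of_one_le (by linarith), one_mul]

theorem of_annulusBump_ne_zero {x : ℝ} (h : annulusBump x ≠ 0) : 1 / 160 ≤ x ∧ x ≤ 3 / 4 := by
  constructor
  · by_contra! hlt
    exact left_ne_zero_of_mul h (Real.smoothTransition.zero_of_nonpos (by linarith))
  · by_contra! hlt
    exact right_ne_zero_of_mul h (Real.smoothTransition.zero_of_nonpos (by linarith))

/-- The comparison function dominates the cut-off Kähler form on `r 𝔻²`; elsewhere it is leafwise
subharmonic up to an error of size `r²`, which lives at a definite distance from the origin. -/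
theorem kahlerCoeff_le_ddbar_comparison {lam r s₀ : ℝ} (hlam : lam < 0) (hr : 0 < r)
    (hr' : r ^ 2 ≤ 1 / 80) (h₀ : 0 < s₀) {q : ℝ → ℝ} {M : ℝ} (hM : 0 < M) (hq : ContDiff ℝ ∞ q)
    (hq1 : ∀ t, t < -2 → deriv q t = 1 ∧ deriv (deriv q) t = 0)
    (hq0 : ∀ t, -1 < t → deriv q t = 0 ∧ deriv (deriv q) t = 0)
    (hqM : ∀ t, -2 ≤ t → t ≤ -1 → |deriv q t| ≤ M ∧ |deriv (deriv q) t| ≤ M)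
    (hF : IsTest lam (comparison lam r s₀ (r ^ (1 - lam)) q)) (p : ℂ × ℂ) :
    (bidisc r).indicator (fun p => levelCutoff lam s₀ (r ^ (1 - lam)) p * kahlerCoeff lam p) p ≤
      4 * (ddbar (⟨comparison lam r s₀ (r ^ (1 - lam)) q, hF⟩ : TestFunction lam)).1 p +
      5 * M * (1 - lam) ^ 2 * r ^ 2 * (levelCutoff lam s₀ (r ^ (1 - lam)) p *
        annulusBump (‖p.1‖ ^ 2) +
        levelCutoff lam s₀ (r ^ (1 - lam)) p * annulusBump (‖p.2‖ ^ 2)) := by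
  rw [ddbar_comparison hr hq hF p]
  have hs₁ : 0 < r ^ (1 - lam) := by positivity
  set c := levelCutoff lam s₀ (r ^ (1 - lam)) p with hc
  have hc0 : 0 ≤ c := levelCutoff_nonneg _ _ _ _
  set V := logPotential r p with hV
  have hE1 := annulusBump_nonneg (‖p.1‖ ^ 2)
  have hE2 := annulusBump_nonneg (‖p.2‖ ^ 2)
  have hd2 := logPotentialDeriv₂_nonneg lam r p
  have herr : 0 ≤ 5 * M * (1 - lam) ^ 2 * r ^ 2 * (c * annulusBump (‖p.1‖ ^ 2) +
        c * annulusBump (‖p.2‖ ^ 2)) := by positivity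
  rcases lt_or_ge V (-2) with h | h
  · obtain ⟨e1, e2⟩ := hq1 V h
    rw [e1, e2]
    have hmain : 0 ≤ r ^ 2 * (c * logPotentialDeriv₂ lam r p) := by positivity
    by_cases hp : p ∈ bidisc r
    · rw [Set.indicator_of_mem hp, ← hc]
      have := mul_le_mul_of_nonneg_left (kahlerCoeff_le_of_mem_bidisc lam hr hp) hc0
      nlinarith
    · rw [Set.indicator_of_notMem hp]
      nlinarith
  · have hp : p ∉ bidisc r := fun hp => absurd (logPotential_lt_of_mem_bidisc hr hr' hp) h.not_gt
    rw [Set.indicator_of_notMem hp]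
    rcases lt_or_ge (-1) V with h' | h'
    · obtain ⟨e1, e2⟩ := hq0 V h'
      rw [e1, e2]
      nlinarith
    rcases hc0.eq_or_lt with hcz | hcz
    · rw [← hcz]; simp
    have hl := (level_of_levelCutoff_ne_zero h₀ hs₁ (hc ▸ hcz.ne')).2
    have hV' := (Real.exp_le_exp.2 h').trans exp_neg_one_le
    have hE : 1 ≤ annulusBump (‖p.1‖ ^ 2) + annulusBump (‖p.2‖ ^ 2) := by
      rcases le_sq_norm_or_le_sq_norm hlam hr hr' hl h with h3 | h3
      · rw [annulusBump_eq_one h3 ((sq_norm_fst_le_exp_logPotential hr p).trans hV')]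
        linarith
      · rw [annulusBump_eq_one h3 ((sq_norm_snd_le_exp_logPotential hr p).trans hV')]
        linarith
    obtain ⟨b1, b2⟩ := hqM V h h'
    -- here `r² χ (q'' V'² + q' V'')` may be negative; it is bounded below termwise
    have i1 : -(M * (1 - lam) ^ 2) ≤ deriv q V * logPotentialDeriv₂ lam r p := by
      have := mul_le_mul b1 (logPotentialDeriv₂_le hlam hr p) hd2 hM.le
      rw [← abs_of_nonneg hd2, ← abs_mul] at this
      linarith [neg_abs_le (deriv q V * logPotentialDeriv₂ lam r p)]
    have i2 : -(M * (4 * (1 - lam) ^ 2)) ≤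
        deriv (deriv q) V * logPotentialDeriv lam r p ^ 2 := by
      have h0 := sq_nonneg (logPotentialDeriv lam r p)
      have := mul_le_mul b2 (sq_logPotentialDeriv_le hlam hr p) h0 hM.le
      rw [← abs_of_nonneg h0, ← abs_mul] at this
      linarith [neg_abs_le (deriv (deriv q) V * logPotentialDeriv lam r p ^ 2)]
    have i3 := mul_le_mul_of_nonneg_left hE
      (by positivity : 0 ≤ r ^ 2 * c * (5 * M * (1 - lam) ^ 2))
    have i4 := mul_le_mul_of_nonneg_left (add_le_add i1 i2) (by positivity : 0 ≤ r ^ 2 * c)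
    nlinarith

/-! ### Small mass near the separatrices -/

theorem contDiff_kahlerCoeff (lam : ℝ) : ContDiff ℝ ∞ (kahlerCoeff lam) := by
  unfold kahlerCoeff vectorField
  exact (contDiff_fst.norm_sq ℝ).add ((contDiff_const.mul contDiff_snd).norm_sq ℝ)

theorem kahlerCoeff_nonneg (lam : ℝ) (p : ℂ × ℂ) : 0 ≤ kahlerCoeff lam p := by
  rw [kahlerCoeff_eq]; positivity

theorem isOpen_regularPart : IsOpen regularPart :=
  ((isOpen_lt continuous_fst.norm continuous_const).inter
    (isOpen_lt continuous_snd.norm continuous_const)).sdiff isClosed_singleton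

/-- Tube lemma around `A × {0}`, with a quantitative radius. -/
theorem exists_pos_ball_prod_subset {A : Set ℂ} (hA : IsCompact A) {U : Set (ℂ × ℂ)}
    (hU : IsOpen U) (h : ∀ z ∈ A, (z, 0) ∈ U) :
    ∃ ε > 0, ∀ p : ℂ × ℂ, p.1 ∈ A → ‖p.2‖ ≤ ε → p ∈ U := by
  have hs : A ×ˢ {(0 : ℂ)} ⊆ U := by
    rintro ⟨z, w⟩ ⟨hz, hw⟩
    obtain rfl : w = 0 := hw
    exact h z hz
  obtain ⟨u, v, -, hv, hu, h0, huv⟩ := generalized_tube_lemma hA isCompact_singleton hU hs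
  obtain ⟨ε, hε, hb⟩ := Metric.nhds_basis_closedBall.mem_iff.1 (hv.mem_nhds (h0 rfl))
  exact ⟨ε, hε, fun p h1 h2 => huv ⟨hu h1, hb (mem_closedBall_zero_iff.2 h2)⟩⟩

theorem isCompact_annulus : IsCompact {z : ℂ | 1 / 160 ≤ ‖z‖ ^ 2 ∧ ‖z‖ ^ 2 ≤ 3 / 4} := by
  refine Metric.isCompact_of_isClosed_isBounded
    ((isClosed_le continuous_const (continuous_norm.pow 2)).inter
      (isClosed_le (continuous_norm.pow 2) continuous_const))
    ((isBounded_iff_forall_norm_le).2 ⟨1, fun z hz => ?_⟩)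
  nlinarith [hz.2, norm_nonneg z]

theorem mem_regularPart_of_annulus {p : ℂ × ℂ}
    (h : 1 / 160 ≤ ‖p.1‖ ^ 2 ∧ ‖p.1‖ ^ 2 ≤ 3 / 4 ∧ ‖p.2‖ ^ 2 ≤ 3 / 4 ∨
      1 / 160 ≤ ‖p.2‖ ^ 2 ∧ ‖p.2‖ ^ 2 ≤ 3 / 4 ∧ ‖p.1‖ ^ 2 ≤ 3 / 4) : p ∈ regularPart := by
  refine ⟨⟨?_, ?_⟩, fun h0 => ?_⟩
  · rcases h with h | h <;> nlinarith [norm_nonneg p.1]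
  · rcases h with h | h <;> nlinarith [norm_nonneg p.2]
  · rw [Set.mem_singleton_iff.1 h0] at h
    norm_num at h

/-- The product of a level cutoff and an annulus cutoff in the coordinate `x` is a test function
supported in `U`, provided small levels force the other coordinate `y` to be small. It is used with
`{x, y} = {z, w}` in both orders, `U` being a neighbourhood of the separatrix `{y = 0}`. -/
theorem isTest_levelCutoff_mul_annulusBump {lam s₀ s₁ : ℝ} (hlam : lam < 0) (h₀ : 0 < s₀)
    (h₁ : 0 < s₁) {x y : ℂ × ℂ → ℂ} (hx : ContDiff ℝ ∞ x) {U : Set (ℂ × ℂ)}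
    (hreg : ∀ p : ℂ × ℂ, 1 / 160 ≤ ‖x p‖ ^ 2 → ‖x p‖ ^ 2 ≤ 3 / 4 → ‖y p‖ ^ 2 ≤ 3 / 4 →
      p ∈ regularPart)
    (hsmall : ∀ p, 1 / 160 ≤ ‖x p‖ ^ 2 → ‖x p‖ ^ 2 ≤ 3 / 4 → level lam p ≤ 2 * s₁ →
      ‖y p‖ ^ 2 ≤ 3 / 4 ∧ p ∈ U) :
    IsTest lam (fun p => levelCutoff lam s₀ s₁ p * annulusBump (‖x p‖ ^ 2)) ∧
      tsupport (fun p => levelCutoff lam s₀ s₁ p * annulusBump (‖x p‖ ^ 2)) ⊆ U := by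
  let S : Set (ℂ × ℂ) :=
    {p | 1 / 160 ≤ ‖x p‖ ^ 2 ∧ ‖x p‖ ^ 2 ≤ 3 / 4 ∧ level lam p ≤ 2 * s₁}
  have hxc := hx.continuous.norm.pow 2
  have hS : IsClosed S := (isClosed_le continuous_const hxc).inter
    ((isClosed_le hxc continuous_const).inter
      (isClosed_le (continuous_level hlam) continuous_const))
  have key : S ⊆ regularPart := fun p hp =>
    hreg p hp.1 hp.2.1 (hsmall p hp.1 hp.2.1 hp.2.2).1
  have := isTest_of_support_subset (lam := lam)
    (f := fun p => levelCutoff lam s₀ s₁ p * annulusBump (‖x p‖ ^ 2))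
    ((contDiff_levelCutoff hlam h₀ h₁).mul (contDiff_annulusBump.comp (hx.norm_sq ℝ)))
    (isCompact_of_isClosed_of_norm_le hS fun p hp => ⟨(key hp).1.1.le, (key hp).1.2.le⟩) key
    fun p hp => by
      have h := of_annulusBump_ne_zero (right_ne_zero_of_mul hp)
      exact ⟨h.1, h.2, (level_of_levelCutoff_ne_zero h₀ h₁ (left_ne_zero_of_mul hp)).2⟩
  exact ⟨this.1, this.2.trans fun p hp => (hsmall p hp.1 hp.2.1 hp.2.2).2⟩

/-- If `T` gives no mass to `{w = 0}`, then it has little mass on the low levels of an annulus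
around the origin in `{w = 0}`. -/
theorem eventually_apply_fst_le {lam : ℝ} (hlam : lam < 0) {T : DirectedHarmonicCurrent lam}
    (hw : T.NoMassOn {p | p ∈ regularPart ∧ p.2 = 0}) {η : ℝ} (hη : 0 < η) :
    ∀ᶠ s₁ in 𝓝[>] (0 : ℝ), ∀ s₀ > 0, ∃ E : TestForm lam,
      (∀ p, E.1 p = levelCutoff lam s₀ s₁ p * annulusBump (‖p.1‖ ^ 2)) ∧
        T.toLinearMap E ≤ 160 * η := by
  obtain ⟨U, hU, hSU, hTU⟩ := hw.exists_isOpen hη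
  obtain ⟨ε, hε, hεU⟩ := exists_pos_ball_prod_subset isCompact_annulus hU fun z hz =>
    hSU ⟨mem_regularPart_of_annulus (p := (z, 0)) (Or.inl ⟨hz.1, hz.2, by norm_num⟩), rfl⟩
  -- `|z|² ≥ 1 / 160` gives `|z| ≥ 1 / 13`; the bound `1 / 2` keeps `w` inside the unit disc
  have hδ : 0 < (1 / 13 : ℝ) ^ (-lam) * min ε (1 / 2) / 2 := by positivity
  filter_upwards [Ioo_mem_nhdsGT hδ] with s₁ hs₁ s₀ h₀
  have hsmall : ∀ p : ℂ × ℂ, 1 / 160 ≤ ‖p.1‖ ^ 2 → level lam p ≤ 2 * s₁ →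
      ‖p.2‖ ≤ min ε (1 / 2) := by
    intro p h1 h2
    have h3 : 1 / 13 ≤ ‖p.1‖ := by
      by_contra! hlt
      nlinarith [norm_nonneg p.1]
    have h4 : (1 / 13 : ℝ) ^ (-lam) * ‖p.2‖ ≤ level lam p :=
      mul_le_mul_of_nonneg_right (Real.rpow_le_rpow (by norm_num) h3 (by linarith)) (norm_nonneg _)
    exact le_of_mul_le_mul_left (by linarith [hs₁.2]) (by positivity : 0 < (1 / 13 : ℝ) ^ (-lam))
  obtain ⟨hE, hEU⟩ := isTest_levelCutoff_mul_annulusBump (x := Prod.fst) (y := Prod.snd) (U := U)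
    hlam h₀ hs₁.1 contDiff_fst
    (fun p a b c => mem_regularPart_of_annulus (Or.inl ⟨a, b, c⟩))
    (fun p a b c => by
      have h := hsmall p a c
      have h' := h.trans (min_le_right _ _)
      exact ⟨by nlinarith [norm_nonneg p.2], hεU p ⟨a, b⟩ (h.trans (min_le_left _ _))⟩)
  refine ⟨⟨_, hE⟩, fun p => rfl, T.apply_le_of_mass_lt (by norm_num) hη.le hTU _ (fun p => ?_) hEU⟩
  have hb0 := annulusBump_nonneg (‖p.1‖ ^ 2)
  have hc0 := levelCutoff_nonneg lam s₀ s₁ p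
  refine ⟨mul_nonneg hc0 hb0, ?_⟩
  change levelCutoff lam s₀ s₁ p * annulusBump (‖p.1‖ ^ 2) ≤ _
  rcases eq_or_ne (annulusBump (‖p.1‖ ^ 2)) 0 with h | h
  · rw [h, mul_zero]; linarith [kahlerCoeff_nonneg lam p]
  · have h1 := (of_annulusBump_ne_zero h).1
    have h2 := mul_le_one₀ (levelCutoff_le_one lam s₀ s₁ p) hb0 (annulusBump_le_one _)
    rw [kahlerCoeff_eq]
    have : 0 ≤ lam ^ 2 * ‖p.2‖ ^ 2 := by positivity
    linarith

/-- If `T` gives no mass to `{z = 0}`, then it has little mass on the low levels of an annulus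
around the origin in `{z = 0}`. -/
theorem eventually_apply_snd_le {lam : ℝ} (hlam : lam < 0) {T : DirectedHarmonicCurrent lam}
    (hz : T.NoMassOn {p | p ∈ regularPart ∧ p.1 = 0}) {η : ℝ} (hη : 0 < η) :
    ∀ᶠ s₁ in 𝓝[>] (0 : ℝ), ∀ s₀ > 0, ∃ E : TestForm lam,
      (∀ p, E.1 p = levelCutoff lam s₀ s₁ p * annulusBump (‖p.2‖ ^ 2)) ∧
        T.toLinearMap E ≤ 160 / lam ^ 2 * η := by
  obtain ⟨U, hU, hSU, hTU⟩ := hz.exists_isOpen hη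
  obtain ⟨ε, hε, hεU⟩ := exists_pos_ball_prod_subset isCompact_annulus
    (hU.preimage continuous_swap) fun z hz' =>
    hSU ⟨mem_regularPart_of_annulus (p := (0, z)) (Or.inr ⟨hz'.1, hz'.2, by norm_num⟩), rfl⟩
  have hδ : 0 < min ε (1 / 2) ^ (-lam) * (1 / 13) / 2 := by positivity
  filter_upwards [Ioo_mem_nhdsGT hδ] with s₁ hs₁ s₀ h₀
  have hsmall : ∀ p : ℂ × ℂ, 1 / 160 ≤ ‖p.2‖ ^ 2 → level lam p ≤ 2 * s₁ →
      ‖p.1‖ ≤ min ε (1 / 2) := by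
    intro p h1 h2
    have h3 : 1 / 13 ≤ ‖p.2‖ := by
      by_contra! hlt
      nlinarith [norm_nonneg p.2]
    by_contra! hlt
    have h4 : min ε (1 / 2) ^ (-lam) * (1 / 13) ≤ level lam p :=
      mul_le_mul (Real.rpow_le_rpow (by positivity) hlt.le (by linarith)) h3 (by norm_num)
        (by positivity)
    linarith [hs₁.2]
  obtain ⟨hE, hEU⟩ := isTest_levelCutoff_mul_annulusBump (x := Prod.snd) (y := Prod.fst) (U := U)
    hlam h₀ hs₁.1 contDiff_snd
    (fun p a b c => mem_regularPart_of_annulus (Or.inr ⟨a, b, c⟩))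
    (fun p a b c => by
      have h := hsmall p a c
      have h' := h.trans (min_le_right _ _)
      exact ⟨by nlinarith [norm_nonneg p.1],
        hεU p.swap ⟨a, b⟩ (h.trans (min_le_left _ _))⟩)
  have hl2 : 0 < lam ^ 2 := sq_pos_of_neg hlam
  refine ⟨⟨_, hE⟩, fun p => rfl, T.apply_le_of_mass_lt (by positivity) hη.le hTU _ (fun p => ?_)
    hEU⟩
  have hb0 := annulusBump_nonneg (‖p.2‖ ^ 2)
  have hc0 := levelCutoff_nonneg lam s₀ s₁ p
  refine ⟨mul_nonneg hc0 hb0, ?_⟩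
  change levelCutoff lam s₀ s₁ p * annulusBump (‖p.2‖ ^ 2) ≤ _
  rcases eq_or_ne (annulusBump (‖p.2‖ ^ 2)) 0 with h | h
  · rw [h, mul_zero]
    exact mul_nonneg (by positivity) (kahlerCoeff_nonneg lam p)
  · have h1 := (of_annulusBump_ne_zero h).1
    have h2 := mul_le_one₀ (levelCutoff_le_one lam s₀ s₁ p) hb0 (annulusBump_le_one _)
    rw [kahlerCoeff_eq, div_mul_eq_mul_div, le_div_iff₀ hl2]
    nlinarith [sq_nonneg ‖p.1‖]

/-- Near a compact part of a set without mass, the Kähler form can be cut off to a test form of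
arbitrarily small mass. -/
theorem exists_bump_of_noMassOn {lam : ℝ} {T : DirectedHarmonicCurrent lam} {S K : Set (ℂ × ℂ)}
    (hS : T.NoMassOn S) (hK : IsCompact K) (hKS : K ⊆ S) (hKr : K ⊆ regularPart) {η : ℝ}
    (hη : 0 < η) : ∃ (ψ : TestForm lam) (V : Set (ℂ × ℂ)), IsOpen V ∧ K ⊆ V ∧
      (∀ p ∈ V, ψ.1 p = kahlerCoeff lam p) ∧ (∀ p, 0 ≤ ψ.1 p) ∧ T.toLinearMap ψ ≤ η := by
  obtain ⟨U, hU, hSU, hTU⟩ := hS.exists_isOpen hη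
  obtain ⟨L, hL, hKL, hLU⟩ := exists_compact_between hK (hU.inter isOpen_regularPart)
    (Set.subset_inter (hKS.trans hSU) hKr)
  obtain ⟨f, hf1, hf0, hf⟩ := exists_contMDiffMap_one_nhds_of_subset_interior
    (n := (⊤ : ℕ∞)) (modelWithCornersSelf ℝ (ℂ × ℂ)) hK.isClosed hKL
  have hfs : ContDiff ℝ ∞ f := f.contMDiff.contDiff
  obtain ⟨V, hV, hKV, hV1⟩ := eventually_nhdsSet_iff_exists.1 hf1
  obtain ⟨hψ, hψL⟩ := isTest_of_support_subset (lam := lam) (f := fun p => f p * kahlerCoeff lam p)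
    (hfs.mul (contDiff_kahlerCoeff lam)) hL (hLU.trans Set.inter_subset_right) fun p hp => by
      by_contra hpL
      exact left_ne_zero_of_mul hp (hf0 p hpL)
  have h0 : ∀ p, 0 ≤ f p * kahlerCoeff lam p := fun p =>
    mul_nonneg (hf p).1 (kahlerCoeff_nonneg lam p)
  refine ⟨⟨_, hψ⟩, V, hV, hKV, fun p hp => ?_, h0, ?_⟩
  · change f p * kahlerCoeff lam p = _
    rw [hV1 p hp, one_mul]
  · have := T.apply_le_of_mass_lt one_pos hη.le hTU ⟨_, hψ⟩
      (fun p => ⟨h0 p, mul_le_mul_of_nonneg_right (hf p).2 (kahlerCoeff_nonneg lam p)⟩)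
      (hψL.trans (hLU.trans Set.inter_subset_left))
    rwa [one_mul] at this

theorem exists_pos_le_level {lam : ℝ} (hlam : lam < 0) {K : Set (ℂ × ℂ)} (hK : IsCompact K)
    (h : ∀ p ∈ K, p.1 ≠ 0 ∧ p.2 ≠ 0) : ∃ s₀ > 0, ∀ p ∈ K, s₀ ≤ level lam p := by
  rcases K.eq_empty_or_nonempty with rfl | hne
  · exact ⟨1, one_pos, fun p hp => hp.elim⟩
  · obtain ⟨p, hp, hmin⟩ := hK.exists_isMinOn hne (continuous_level hlam).continuousOn
    exact ⟨level lam p, (level_pos_iff hlam p).2 (h p hp), fun x hx => hmin hx⟩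

/-! ### Vanishing of the Lelong number -/

/-- The mass of `T` on `r 𝔻²` is `o(r²)`, tested against a single form `φ`. Testing the harmonicity
of `T` against the comparison function trades `φ` for the annulus errors, up to the part of `φ`
near the separatrices, whose mass is made small separately. -/
theorem eventually_apply_le {lam : ℝ} (hlam : lam < 0) (T : DirectedHarmonicCurrent lam)
    (hz : T.NoMassOn {p | p ∈ regularPart ∧ p.1 = 0})
    (hw : T.NoMassOn {p | p ∈ regularPart ∧ p.2 = 0}) {ε : ℝ} (hε : 0 < ε) :
    ∀ᶠ r in 𝓝[>] (0 : ℝ), ∀ φ : TestForm lam,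
      (∀ p, 0 ≤ φ.1 p ∧ φ.1 p ≤ kahlerCoeff lam p) → tsupport φ.1 ⊆ bidisc r →
        T.toLinearMap φ ≤ ε * r ^ 2 := by
  obtain ⟨q, M, hq, hM, hqz, hq1, hq0, hqM⟩ := exists_smooth_truncation
  have hl2 : 0 < lam ^ 2 := sq_pos_of_neg hlam
  have hlam' : 0 < 1 - lam := by linarith
  have hA : 0 < 5 * M * (1 - lam) ^ 2 := by positivity
  have hB : 0 < 160 + 160 / lam ^ 2 := by positivity
  set A := 5 * M * (1 - lam) ^ 2
  set B := 160 + 160 / lam ^ 2 with hBdef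
  set η := ε / (2 * A * B) with hη
  have hη0 : 0 < η := by positivity
  -- `r ^ (1 - lam)` is the supremum of the level on the bidisc of radius `r`
  have hs₁ : Filter.Tendsto (fun r : ℝ => r ^ (1 - lam)) (𝓝[>] 0) (𝓝[>] 0) := by
    refine tendsto_nhdsWithin_iff.2 ⟨?_, ?_⟩
    · have := (Real.continuous_rpow_const (q := 1 - lam) (by linarith)).tendsto 0
      rw [Real.zero_rpow (by linarith)] at this
      exact this.mono_left nhdsWithin_le_nhds
    · filter_upwards [self_mem_nhdsWithin] with r hr using Real.rpow_pos_of_pos hr _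
  filter_upwards [hs₁.eventually (eventually_apply_fst_le hlam hw hη0),
    hs₁.eventually (eventually_apply_snd_le hlam hz hη0),
    Ioo_mem_nhdsGT (by norm_num : (0 : ℝ) < 1 / 9)] with r hEw hEz hr φ hφ hsupp
  have hr0 : 0 < r := hr.1
  have hr' : r ^ 2 ≤ 1 / 80 := by nlinarith [hr.2]
  have hφT : IsTest lam φ.1 := φ.2
  have hK : IsCompact (tsupport φ.1) := hφT.compact
  have hη' : 0 < ε / 4 * r ^ 2 := by positivity
  -- cut off neighbourhoods of the separatrices, at a cost that may depend on `r`
  obtain ⟨ψz, Vz, hVz, hKVz, hψz, hψz0, hTz⟩ := exists_bump_of_noMassOn hz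
    (hK.inter_right (isClosed_singleton.preimage continuous_fst : IsClosed {p : ℂ × ℂ | p.1 = 0}))
    (fun p hp => ⟨hφT.support hp.1, hp.2⟩) (fun p hp => hφT.support hp.1) hη'
  obtain ⟨ψw, Vw, hVw, hKVw, hψw, hψw0, hTw⟩ := exists_bump_of_noMassOn hw
    (hK.inter_right (isClosed_singleton.preimage continuous_snd : IsClosed {p : ℂ × ℂ | p.2 = 0}))
    (fun p hp => ⟨hφT.support hp.1, hp.2⟩) (fun p hp => hφT.support hp.1) hη'
  obtain ⟨s₀, hs₀, hs₀K⟩ := exists_pos_le_level hlam (hK.diff (hVz.union hVw)) fun p hp =>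
    ⟨fun h => hp.2 (Or.inl (hKVz ⟨hp.1, h⟩)), fun h => hp.2 (Or.inr (hKVw ⟨hp.1, h⟩))⟩
  obtain ⟨Ew, hEw, hTEw⟩ := hEw s₀ hs₀
  obtain ⟨Ez, hEz, hTEz⟩ := hEz s₀ hs₀
  have hs₁0 : 0 < r ^ (1 - lam) := by positivity
  have hF : IsTest lam (comparison lam r s₀ (r ^ (1 - lam)) q) :=
    isTest_comparison hlam hr0 hs₀ hs₁0 hq hqz
  set F : TestFunction lam := ⟨_, hF⟩
  -- on `supp φ`, either a separatrix cutoff or the level cutoff is `1`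
  have hle : ∀ p, φ.1 p ≤
      ((4 : ℝ) • ddbar F + (A * r ^ 2) • (Ew + Ez) + ψz + ψw : TestForm lam).1 p := by
    intro p
    have hmain := kahlerCoeff_le_ddbar_comparison hlam hr0 hr' hs₀ hM hq hq1 hq0 hqM hF p
    change _ ≤ 4 * (ddbar F).1 p + A * r ^ 2 * (Ew.1 p + Ez.1 p) + ψz.1 p + ψw.1 p
    rw [hEw, hEz]
    have hz0 := hψz0 p
    have hw0 := hψw0 p
    have hi : 0 ≤ (bidisc r).indicator
        (fun p => levelCutoff lam s₀ (r ^ (1 - lam)) p * kahlerCoeff lam p) p :=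
      Set.indicator_nonneg (fun p _ => mul_nonneg (levelCutoff_nonneg _ _ _ _)
        (kahlerCoeff_nonneg _ _)) p
    by_cases hp : p ∈ tsupport φ.1
    · by_cases hpz : p ∈ Vz
      · linarith [(hφ p).2, hψz p hpz]
      by_cases hpw : p ∈ Vw
      · linarith [(hφ p).2, hψw p hpw]
      have hcut := levelCutoff_eq_one hs₀ hs₁0 (hs₀K p ⟨hp, fun h => h.elim hpz hpw⟩)
        (level_le_of_mem_bidisc hlam hr0 (hsupp hp))
      rw [Set.indicator_of_mem (hsupp hp), hcut, one_mul] at hmain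
      rw [hcut]
      linarith [(hφ p).2]
    · rw [image_eq_zero_of_notMem_tsupport hp]
      linarith
  have hT := T.apply_mono hle
  simp only [map_add, map_smul, smul_eq_mul, T.harmonic] at hT
  have hsum : A * r ^ 2 * (T.toLinearMap Ew + T.toLinearMap Ez) ≤ A * r ^ 2 * (B * η) :=
    mul_le_mul_of_nonneg_left (by rw [hBdef, add_mul]; linarith) (by positivity)
  have hABη : A * r ^ 2 * (B * η) = ε / 2 * r ^ 2 := by
    rw [hη]; field_simp
  linarith

theorem lelongNumber_eq_zero {lam : ℝ} (hlam : lam < 0) (T : DirectedHarmonicCurrent lam)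
    (hz : T.NoMassOn {p | p ∈ regularPart ∧ p.1 = 0})
    (hw : T.NoMassOn {p | p ∈ regularPart ∧ p.2 = 0}) : T.lelongNumber = 0 := by
  refine le_antisymm (le_of_forall_pos_le_add fun ε hε => ?_) bot_le
  rw [zero_add]
  rcases eq_or_ne ε ⊤ with rfl | hεtop
  · exact le_top
  have hε' : 0 < ε.toReal := ENNReal.toReal_pos hε.ne' hεtop
  refine Filter.limsup_le_of_le (h := ?_)
  filter_upwards [eventually_apply_le hlam T hz hw (mul_pos Real.pi_pos hε'),
    self_mem_nhdsWithin] with r hr hr0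
  have hr0 : 0 < r := hr0
  refine ENNReal.div_le_of_le_mul ?_
  rw [← ENNReal.ofReal_toReal hεtop, ← ENNReal.ofReal_mul hε'.le]
  refine iSup_le fun φ => iSup_le fun hφ => iSup_le fun hs => ENNReal.ofReal_le_ofReal ?_
  linarith [hr φ hφ hs]

end LinFoliation

theorem mainTheorem2 (lam : ℝ) (hlam : lam < 0)
    (T : LinFoliation.DirectedHarmonicCurrent lam)
    (hfin : T.mass (LinFoliation.bidisc 1) < ⊤)
    (hz : T.NoMassOn {p | p ∈ LinFoliation.regularPart ∧ p.1 = 0})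
    (hw : T.NoMassOn {p | p ∈ LinFoliation.regularPart ∧ p.2 = 0}) :
    (T.IsPeriodic → T.lelongNumber = 0) ∧
      (lam ∈ Set.range ((↑) : ℚ → ℝ) → T.lelongNumber = 0) :=
  ⟨fun _ => LinFoliation.lelongNumber_eq_zero hlam T hz hw,
    fun _ => LinFoliation.lelongNumber_eq_zero hlam T hz hw⟩
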